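/- Let $p\ge 1$ and let $D=(d_{ij})_{i,j\ge 1}$ be a complex banded matrix of order $p$, that is, $d_{ij}=0$ for $|i-j|>p$ and $d_{ij}\neq 0$ for $|i-j|=p$. Assume that $\lim_{i\to\infty} d_{i,i\pm p}=1$ and $\lim_{i\to\infty} d_{i,i\pm r}=0$ for $0\le r<p$, so that $D$ generates a bounded operator on $\ell^2(\mathbb N)$, $\mathbb N=\{1,2,\dots\}$, also denoted by $D$. Extend the coefficients to indices $i,j\ge 1-p$ with $\min(i,j)\le 0$ by $d_{ij}=1$ if $|i-j|=p$ and $d_{ij}=0$ otherwise. For $\lambda\in\mathbb C$ consider the recurrence $$d_{n,n-p}\,y_{n-p}+d_{n,n-p+1}\,y_{n-p+1}+\dots+d_{n,n+p}\,y_{n+p}=\lambda y_n,\qquad n=1,2,\dots,\tag{$*$}$$ for complex sequences $(y_n)_{n\ge 1-p}$. Let $\lambda\in\mathbb C\setminus[-2,2]$. Then: 1. The vector space of solutions of $(*)$ with $\sum_{n\ge 1-p}|y_n|^2<\infty$ has dimension exactly $p$. 2. If $(y^{(i)}_n)_{n\ge 1-p}$, $i=1,\dots,p$, are any linearly independent square-summable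 solutions of $(*)$, then $\lambda$ is an eigenvalue of the operator $D$ on $\ell^2(\mathbb N)$ if and only if $$\det\begin{pmatrix} y^{(1)}_{1-p} & y^{(1)}_{2-p} & \dots & y^{(1)}_0\\ \vdots & \vdots & & \vdots\\ y^{(p)}_{1-p} & y^{(p)}_{2-p} & \dots & y^{(p)}_0\end{pmatrix}=0 .$$ -/

import Mathlib

open Filter Topology
open scoped ENNReal

/-- The complex Hilbert space `ℓ²` of square-summable sequences.  Sequences are indexed by
`ℕ = {0, 1, 2, …}`, so the coordinate `k` is the `(k + 1)`-st coordinate in the mathematical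
convention in which indices start at `1`. -/
abbrev EllTwo : Type := lp (fun _ : ℕ => ℂ) 2

/-- A complex banded matrix `D = (d_{ij})_{i,j ≥ 1}` of order `p` (zero for `|i - j| > p`, nonzero
for `|i - j| = p`) which stabilizes to the standard one: the two extreme diagonals tend
to `1`, and all the diagonals strictly between them tend to `0`.
Rows and columns are numbered from `0`: `entry i j` is `d_{i+1,j+1}`. -/
structure StabilizingBandedMatrix (p : ℕ) where
  entry : Matrix ℕ ℕ ℂ
  entry_eq_zero : ∀ i j, i + p < j ∨ j + p < i → entry i j = 0
  entry_ne_zero : ∀ i j, i + p = j ∨ j + p = i → entry i j ≠ 0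
  tendsto_upper : Tendsto (fun i => entry i (i + p)) atTop (𝓝 1)
  tendsto_lower : Tendsto (fun i => entry (i + p) i) atTop (𝓝 1)
  tendsto_inner_upper : ∀ r < p, Tendsto (fun i => entry i (i + r)) atTop (𝓝 0)
  tendsto_inner_lower : ∀ r < p, Tendsto (fun i => entry (i + r) i) atTop (𝓝 0)

namespace StabilizingBandedMatrix

variable {p : ℕ} (D : StabilizingBandedMatrix p)

theorem exists_entry_bound : ∃ C : ℝ, 0 ≤ C ∧ ∀ i j, ‖D.entry i j‖ ≤ C := by
  have key : ∀ f : ℕ → ℂ, (∃ a, Tendsto f atTop (𝓝 a)) → ∃ C : ℝ, ∀ i, ‖f i‖ ≤ C := by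
    rintro f ⟨a, h⟩
    obtain ⟨C, hC⟩ := (Metric.isBounded_range_of_tendsto f h).exists_norm_le
    exact ⟨C, fun i => hC _ ⟨i, rfl⟩⟩
  have hU : ∀ r, ∃ C : ℝ, ∀ i, ‖D.entry i (i + r)‖ ≤ C := by
    intro r
    apply key
    rcases lt_trichotomy r p with h | h | h
    · exact ⟨0, D.tendsto_inner_upper r h⟩
    · exact ⟨1, h ▸ D.tendsto_upper⟩
    · refine ⟨0, tendsto_const_nhds.congr fun i => ?_⟩
      exact (D.entry_eq_zero i (i + r) (Or.inl (by omega))).symm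
  have hL : ∀ r, ∃ C : ℝ, ∀ i, ‖D.entry (i + r) i‖ ≤ C := by
    intro r
    apply key
    rcases lt_trichotomy r p with h | h | h
    · exact ⟨0, D.tendsto_inner_lower r h⟩
    · exact ⟨1, h ▸ D.tendsto_lower⟩
    · refine ⟨0, tendsto_const_nhds.congr fun i => ?_⟩
      exact (D.entry_eq_zero (i + r) i (Or.inr (by omega))).symm
  choose U hU using hU
  choose L hL using hL
  have hU0 : ∀ r, 0 ≤ U r := fun r => (norm_nonneg _).trans (hU r 0)
  have hL0 : ∀ r, 0 ≤ L r := fun r => (norm_nonneg _).trans (hL r 0)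
  have hs : 0 ≤ ∑ r ∈ Finset.range (p + 1), (U r + L r) :=
    Finset.sum_nonneg fun r _ => add_nonneg (hU0 r) (hL0 r)
  have hle : ∀ r ≤ p, U r + L r ≤ ∑ r ∈ Finset.range (p + 1), (U r + L r) := fun r hr =>
    Finset.single_le_sum (f := fun r => U r + L r)
      (fun r _ => add_nonneg (hU0 r) (hL0 r)) (Finset.mem_range.2 (by omega))
  refine ⟨_, hs, fun i j => ?_⟩
  rcases le_total i j with h | h
  · obtain ⟨r, rfl⟩ := Nat.exists_eq_add_of_le h
    by_cases hr : r ≤ p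
    · linarith [hU r i, hL0 r, hle r hr]
    · rw [D.entry_eq_zero i (i + r) (Or.inl (by omega)), norm_zero]; exact hs
  · obtain ⟨r, rfl⟩ := Nat.exists_eq_add_of_le h
    by_cases hr : r ≤ p
    · linarith [hL r j, hU0 r, hle r hr]
    · rw [D.entry_eq_zero (j + r) j (Or.inr (by omega)), norm_zero]; exact hs

/-- The product of the matrix with a column vector (each row has finitely many nonzero entries). -/
noncomputable def mulVec (y : ℕ → ℂ) (i : ℕ) : ℂ := ∑' j, D.entry i j * y j

theorem mulVec_eq_sum (y : ℕ → ℂ) (i : ℕ) :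
    D.mulVec y i = ∑ j ∈ Finset.Icc (i - p) (i + p), D.entry i j * y j := by
  refine tsum_eq_sum fun j hj => ?_
  rw [Finset.mem_Icc] at hj
  rw [D.entry_eq_zero i j (by omega), zero_mul]

theorem exists_mulVec_bound : ∃ K : ℝ, 0 ≤ K ∧ ∀ (y : EllTwo) (s : Finset ℕ),
    ∑ i ∈ s, ‖D.mulVec y i‖ ^ (2 : ℝ≥0∞).toReal ≤ (K * ‖y‖) ^ (2 : ℝ≥0∞).toReal := by
  obtain ⟨C, hC0, hC⟩ := D.exists_entry_bound
  refine ⟨(2 * p + 1) * C, by positivity, fun y s => ?_⟩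
  have h2 : (2 : ℝ≥0∞).toReal = ((2 : ℕ) : ℝ) := by norm_num
  simp only [h2, Real.rpow_natCast]
  have hrow : ∀ i, ‖D.mulVec y i‖ ^ 2 ≤
      ((2 * p + 1) * C ^ 2) * ∑ j ∈ Finset.Icc (i - p) (i + p), ‖y j‖ ^ 2 := by
    intro i
    have h1 : ‖D.mulVec y i‖ ≤ C * ∑ j ∈ Finset.Icc (i - p) (i + p), ‖y j‖ := by
      rw [mulVec_eq_sum, Finset.mul_sum]
      refine (norm_sum_le _ _).trans (Finset.sum_le_sum fun j _ => ?_)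
      rw [norm_mul]
      exact mul_le_mul_of_nonneg_right (hC i j) (norm_nonneg _)
    have h3 := sq_sum_le_card_mul_sum_sq (s := Finset.Icc (i - p) (i + p)) (f := fun j => ‖y j‖)
    have h4 : ((Finset.Icc (i - p) (i + p)).card : ℝ) ≤ 2 * p + 1 := by
      rw [Nat.card_Icc]; norm_cast; omega
    have h5 : 0 ≤ ∑ j ∈ Finset.Icc (i - p) (i + p), ‖y j‖ ^ 2 :=
      Finset.sum_nonneg fun _ _ => by positivity
    calc ‖D.mulVec y i‖ ^ 2 ≤ (C * ∑ j ∈ Finset.Icc (i - p) (i + p), ‖y j‖) ^ 2 :=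
          pow_le_pow_left₀ (norm_nonneg _) h1 2
      _ = C ^ 2 * (∑ j ∈ Finset.Icc (i - p) (i + p), ‖y j‖) ^ 2 := by ring
      _ ≤ C ^ 2 * ((2 * p + 1) * ∑ j ∈ Finset.Icc (i - p) (i + p), ‖y j‖ ^ 2) :=
          mul_le_mul_of_nonneg_left (h3.trans (mul_le_mul_of_nonneg_right h4 h5)) (by positivity)
      _ = _ := by ring
  have hdouble : ∑ i ∈ s, ∑ j ∈ Finset.Icc (i - p) (i + p), ‖y j‖ ^ 2 ≤
      (2 * p + 1) * ‖y‖ ^ 2 := by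
    rw [Finset.sum_comm' (t' := s.biUnion fun i => Finset.Icc (i - p) (i + p))
      (s' := fun j => s.filter fun i => j ∈ Finset.Icc (i - p) (i + p))
      (by intro i j; simp only [Finset.mem_biUnion, Finset.mem_filter]; tauto)]
    have hc : ∀ j, ((s.filter fun i => j ∈ Finset.Icc (i - p) (i + p)).card : ℝ) ≤ 2 * p + 1 := by
      intro j
      have : (s.filter fun i => j ∈ Finset.Icc (i - p) (i + p)) ⊆ Finset.Icc (j - p) (j + p) := by
        intro i hi
        simp only [Finset.mem_filter, Finset.mem_Icc] at hi ⊢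
        omega
      have h := Finset.card_le_card this
      rw [Nat.card_Icc] at h
      norm_cast; omega
    have hn := lp.sum_rpow_le_norm_rpow (p := 2) (by norm_num) y
      (s.biUnion fun i => Finset.Icc (i - p) (i + p))
    simp only [h2, Real.rpow_natCast] at hn
    calc _ ≤ ∑ j ∈ s.biUnion (fun i => Finset.Icc (i - p) (i + p)), (2 * p + 1 : ℝ) * ‖y j‖ ^ 2 := by
          refine Finset.sum_le_sum fun j _ => ?_
          rw [Finset.sum_const, nsmul_eq_mul]
          exact mul_le_mul_of_nonneg_right (hc j) (by positivity)
      _ ≤ _ := by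
          rw [← Finset.mul_sum]
          exact mul_le_mul_of_nonneg_left hn (by positivity)
  calc _ ≤ ∑ i ∈ s, ((2 * p + 1) * C ^ 2) * ∑ j ∈ Finset.Icc (i - p) (i + p), ‖y j‖ ^ 2 :=
        Finset.sum_le_sum fun i _ => hrow i
    _ ≤ ((2 * p + 1) * C ^ 2) * ((2 * p + 1) * ‖y‖ ^ 2) := by
        rw [← Finset.mul_sum]
        exact mul_le_mul_of_nonneg_left hdouble (by positivity)
    _ = _ := by ring

theorem memℓp_mulVec (y : EllTwo) : Memℓp (D.mulVec y) 2 := by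
  obtain ⟨K, -, h⟩ := D.exists_mulVec_bound
  exact memℓp_gen' (h y)

/-- The bounded operator on `ℓ²` generated by the matrix `D`: `(D y)_i = ∑_j d_{ij} y_j`. -/
noncomputable def operator : EllTwo →L[ℂ] EllTwo :=
  LinearMap.mkContinuousOfExistsBound
    { toFun := fun y => ⟨D.mulVec y, D.memℓp_mulVec y⟩
      map_add' := by
        intro x y
        ext i
        simp only [lp.coeFn_add, Pi.add_apply, mulVec_eq_sum, mul_add, Finset.sum_add_distrib]
      map_smul' := by
        intro c x
        ext i
        simp only [lp.coeFn_smul, Pi.smul_apply, mulVec_eq_sum, smul_eq_mul, RingHom.id_apply,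
          Finset.mul_sum]
        exact Finset.sum_congr rfl fun j _ => by ring }
    (by
      obtain ⟨K, hK, h⟩ := D.exists_mulVec_bound
      exact ⟨K, fun y => lp.norm_le_of_forall_sum_le (by norm_num) (by positivity) (h y)⟩)

theorem operator_apply (y : EllTwo) (i : ℕ) :
    D.operator y i = ∑' j, D.entry i j * y j := rfl

/-- The coefficients `d_{ij}` extended to all indices `i, j ≥ 1 - p` by the entries of the standard
banded matrix: if `min(i, j) ≤ 0`, then `d_{ij} = 1` for `|i - j| = p` and `d_{ij} = 0` otherwise.
The indices `1 - p, 2 - p, …` are numbered here from `0`, so that `extEntry m l` is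
`d_{m+1-p,l+1-p}`; the original matrix occupies the range `p ≤ m`, `p ≤ l`. -/
def extEntry (m l : ℕ) : ℂ :=
  if p ≤ m ∧ p ≤ l then D.entry (m - p) (l - p)
  else if m + p = l ∨ l + p = m then 1 else 0

/-- The recurrence
`d_{n,n-p} y_{n-p} + d_{n,n-p+1} y_{n-p+1} + ⋯ + d_{n,n+p} y_{n+p} = lam * y_n`, `n = 1, 2, …`,
for a sequence `(y_n)_{n ≥ 1-p}`.  As above the indices `1 - p, 2 - p, …` are numbered from `0`
(`y k` is `y_{k+1-p}`), so that the equation with number `n` is the one with `m = n - 1` below. -/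
def IsSolution (lam : ℂ) (y : ℕ → ℂ) : Prop :=
  ∀ m : ℕ, ∑ l ∈ Finset.Icc m (m + 2 * p), D.extEntry (m + p) l * y l = lam * y (m + p)

/-- The vector space of square-summable solutions `(y_n)_{n ≥ 1-p}` of the recurrence. -/
def ellTwoSolutions (lam : ℂ) : Submodule ℂ (ℕ → ℂ) where
  carrier := {y | Memℓp y 2 ∧ D.IsSolution lam y}
  zero_mem' := ⟨zero_memℓp, fun m => by simp⟩
  add_mem' := by
    rintro x y ⟨hx, hx'⟩ ⟨hy, hy'⟩
    refine ⟨hx.add hy, fun m => ?_⟩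
    simp only [Pi.add_apply, mul_add, Finset.sum_add_distrib, hx' m, hy' m]
  smul_mem' := by
    rintro c x ⟨hx, hx'⟩
    refine ⟨hx.const_smul c, fun m => ?_⟩
    simp only [Pi.smul_apply, smul_eq_mul, mul_left_comm _ c, ← Finset.mul_sum, hx' m]

end StabilizingBandedMatrix

/-! ### Inverting the factored limit operator. -/

section Algebra

/-! Far out, the recurrence is close to `z m - lam * z (m + p) + z (m + 2 * p) = 0`. With `S`, `R`
the left and right shifts by `p`, its operator is `(S - a⁻¹) (S - a)`, where `a + a⁻¹ = lam` and `0
< ‖a‖ < 1`; such an `a` exists because `lam` avoids `[-2, 2]`. A recurrence operator `T` is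
completed to `(1 - R S) + R T`, which records the first `p` terms and then `T z`. If this is
invertible, `p` arbitrary initial terms extend uniquely to a square-summable solution, so the
dimension is `p` (`rank_ellTwoKernel_of_isUnit`). The limit operator has this property
(`isUnit_boundary_add_factored`), and invertibility is an open condition, so a tail of the
recurrence has it too. Nonzero lowest coefficients carry the dimension back to the full recurrence
(`rank_ellTwoKernel_add`). Eigenvectors are the square-summable solutions starting with `p` zeros;
expanded in a basis, they are the row vectors killed by the matrix of initial values. -/

theorem exists_add_inv_eq_of_forall_ne_real {lam : ℂ}
    (hlam : ∀ x : ℝ, x ∈ Set.Icc (-2 : ℝ) 2 → lam ≠ (x : ℂ)) :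
    ∃ a : ℂ, a ≠ 0 ∧ ‖a‖ < 1 ∧ a + a⁻¹ = lam := by
  obtain ⟨s, hs⟩ := IsAlgClosed.exists_pow_nat_eq (lam ^ 2 - 4) (n := 2) (by norm_num)
  obtain ⟨a, ha⟩ : ∃ a : ℂ, a * (lam - a) = 1 := ⟨(lam + s) / 2, by linear_combination -hs / 4⟩
  have ha0 : a ≠ 0 := by rintro rfl; simp at ha
  have hinv : a⁻¹ = lam - a := inv_eq_of_mul_eq_one_right ha
  rcases lt_trichotomy ‖a‖ 1 with h | h | h
  · exact ⟨a, ha0, h, by rw [hinv]; ring⟩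
  -- On the unit circle `a⁻¹` is the conjugate of `a`, so `lam = 2 * a.re` would lie in `[-2, 2]`.
  · exfalso
    have hconj : a⁻¹ = (starRingEnd ℂ) a := Complex.inv_eq_conj h
    refine hlam (2 * a.re) ?_ ?_
    · have := abs_le.1 ((Complex.abs_re_le_norm a).trans h.le)
      constructor <;> linarith [this.1, this.2]
    · have h1 : lam = a + (starRingEnd ℂ) a := by rw [← hconj, hinv]; ring
      rw [h1, Complex.add_conj]
  · refine ⟨a⁻¹, inv_ne_zero ha0, ?_, by rw [inv_inv, hinv]; ring⟩
    rw [norm_inv]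
    exact inv_lt_one_of_one_lt₀ h

/-- If `S` and `R` are contractions with `S R = 1` (one-sided shifts, say), then the equation
`(S - a⁻¹) (S - a) z = w` is uniquely solvable with prescribed component `(1 - R S) z`. -/
theorem isUnit_boundary_add_factored {A : Type*} [NormedRing A] [NormedAlgebra ℂ A]
    [CompleteSpace A] {S R : A} (hSR : S * R = 1) (hS : ‖S‖ ≤ 1) (hR : ‖R‖ ≤ 1) {a : ℂ}
    (ha0 : a ≠ 0) (ha : ‖a‖ < 1) :
    IsUnit ((1 - R * S) + R * ((S - a⁻¹ • 1) * (S - a • 1))) := by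
  have hsmul : ∀ t : A, ‖t‖ ≤ 1 → IsUnit (1 - a • t) := fun t ht => by
    refine isUnit_one_sub_of_norm_lt_one ?_
    rw [norm_smul]
    exact (mul_le_of_le_one_right (norm_nonneg _) ht).trans_lt ha
  -- `S R = 1` gives `S - a = S (1 - a R)` and `1 - R S = (1 - R S) (1 - a R)`, so `1 - a R` splits
  -- off on the right.
  have hfac : (1 - R * S) + R * ((S - a⁻¹ • 1) * (S - a • 1)) =
      ((1 - R * S) + R * (S - a⁻¹ • 1) * S) * (1 - a • R) := by
    have e1 : S * (R * S) = S := by rw [← mul_assoc, hSR, one_mul]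
    simp only [mul_sub, sub_mul, add_mul, mul_one, one_mul, mul_smul_comm, smul_mul_assoc,
      mul_assoc, hSR, smul_add, smul_sub, smul_smul, mul_inv_cancel₀ ha0, one_smul]
    abel
  rw [hfac]
  refine IsUnit.mul ?_ (hsmul R hR)
  have hSb : IsUnit (S - a⁻¹ • (1 : A)) := by
    have e : S - a⁻¹ • (1 : A) = (-a⁻¹) • (1 - a • S) := by
      rw [smul_sub, smul_smul, neg_mul, inv_mul_cancel₀ ha0]
      simp only [neg_smul, one_smul]
      abel
    rw [e]
    exact (isUnit_smul_iff (Units.mk0 (-a⁻¹) (by simpa using ha0)) _).2 (hsmul S hS)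
  obtain ⟨u, hu⟩ := hSb
  -- The map `x ↦ (1 - R S) + R x S` is multiplicative and fixes `1`, hence preserves units.
  have key : ∀ x y : A, x * y = 1 →
      ((1 - R * S) + R * x * S) * ((1 - R * S) + R * y * S) = 1 := fun x y hxy => by
    have e1 : ∀ t, S * (R * t) = t := fun t => by rw [← mul_assoc, hSR, one_mul]
    have e2 : ∀ t, x * (y * t) = t := fun t => by rw [← mul_assoc, hxy, one_mul]
    simp only [mul_sub, sub_mul, add_mul, mul_add, mul_one, one_mul, mul_assoc, e1, e2]
    abel
  rw [← hu]
  exact ⟨⟨_, _, key _ _ u.mul_inv, key _ _ u.inv_mul⟩, rfl⟩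

end Algebra

/-! ### Weighted shifts on `ℓ²`. -/

section WeightedComposition

/-- Where `w` is nonzero the indices `g m` are distinct, so each coordinate of `z` is counted at
most once. -/
theorem EllTwo.sum_norm_weighted_comp_le {w : ℕ → ℂ} {g : ℕ → ℕ} {C : ℝ} (hC : ∀ m, ‖w m‖ ≤ C)
    (hg : Set.InjOn g {m | w m ≠ 0}) (z : EllTwo) (s : Finset ℕ) :
    ∑ m ∈ s, ‖w m * z (g m)‖ ^ (2 : ℝ≥0∞).toReal ≤ (C * ‖z‖) ^ (2 : ℝ≥0∞).toReal := by
  have h2 : (2 : ℝ≥0∞).toReal = ((2 : ℕ) : ℝ) := by norm_num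
  have hinj : Set.InjOn g (s.filter fun m => w m ≠ 0) := fun x hx y hy h =>
    hg (Finset.mem_filter.1 hx).2 (Finset.mem_filter.1 hy).2 h
  have hn := lp.sum_rpow_le_norm_rpow (p := 2) (by norm_num) z
    ((s.filter fun m => w m ≠ 0).image g)
  rw [Finset.sum_image hinj] at hn
  simp only [h2, Real.rpow_natCast] at hn ⊢
  calc ∑ m ∈ s, ‖w m * z (g m)‖ ^ 2
      = ∑ m ∈ s.filter (fun m => w m ≠ 0), ‖w m * z (g m)‖ ^ 2 := by
        refine (Finset.sum_filter_of_ne (p := fun m => w m ≠ 0) fun m _ h hw => h ?_).symm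
        simp [hw]
    _ ≤ ∑ m ∈ s.filter (fun m => w m ≠ 0), C ^ 2 * ‖z (g m)‖ ^ 2 := by
        refine Finset.sum_le_sum fun m _ => ?_
        rw [norm_mul, mul_pow]
        gcongr
        exact hC m
    _ ≤ _ := by
        rw [← Finset.mul_sum, mul_pow]
        gcongr

/-- The operator `(z_m) ↦ (w_m z_{g(m)})` on `ℓ²`, where `w` is bounded and `g` is injective on the
support of `w`. -/
noncomputable def EllTwo.weightedComp (w : ℕ → ℂ) (g : ℕ → ℕ) (C : ℝ) (hC : ∀ m, ‖w m‖ ≤ C)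
    (hg : Set.InjOn g {m | w m ≠ 0}) : EllTwo →L[ℂ] EllTwo :=
  LinearMap.mkContinuous
    { toFun := fun z => ⟨fun m => w m * z (g m),
        memℓp_gen' (EllTwo.sum_norm_weighted_comp_le hC hg z)⟩
      map_add' := fun x y => by
        ext m
        simp only [lp.coeFn_add, Pi.add_apply, mul_add]
      map_smul' := fun c x => by
        ext m
        simp only [lp.coeFn_smul, Pi.smul_apply, smul_eq_mul, RingHom.id_apply]
        ring }
    C fun z => lp.norm_le_of_forall_sum_le (by norm_num)
      (mul_nonneg ((norm_nonneg _).trans (hC 0)) (norm_nonneg _))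
      (EllTwo.sum_norm_weighted_comp_le hC hg z)

theorem EllTwo.weightedComp_apply {w : ℕ → ℂ} {g : ℕ → ℕ} {C : ℝ} (hC : ∀ m, ‖w m‖ ≤ C)
    (hg : Set.InjOn g {m | w m ≠ 0}) (z : EllTwo) (m : ℕ) :
    EllTwo.weightedComp w g C hC hg z m = w m * z (g m) := rfl

theorem EllTwo.norm_weightedComp_le {w : ℕ → ℂ} {g : ℕ → ℕ} {C : ℝ} (hC : ∀ m, ‖w m‖ ≤ C)
    (hg : Set.InjOn g {m | w m ≠ 0}) : ‖EllTwo.weightedComp w g C hC hg‖ ≤ C :=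
  LinearMap.mkContinuous_norm_le _ ((norm_nonneg _).trans (hC 0)) _

/-- The left shift by `r` places on `ℓ²`. -/
noncomputable def EllTwo.leftShift (r : ℕ) : EllTwo →L[ℂ] EllTwo :=
  EllTwo.weightedComp (fun _ => 1) (· + r) 1 (by simp) (fun x _ y _ h => by simpa using h)

/-- The right shift by `r` places on `ℓ²`. -/
noncomputable def EllTwo.rightShift (r : ℕ) : EllTwo →L[ℂ] EllTwo :=
  -- Truncated subtraction sends every `m < r` to `0`; the zero weight there keeps the index map
  -- injective on the support.
  EllTwo.weightedComp (fun m => if m < r then 0 else 1) (· - r) 1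
    (fun m => by split_ifs <;> simp) (fun x hx y hy h => by
      simp only [Set.mem_ofPred_eq, ne_eq, ite_eq_left_iff, one_ne_zero, imp_false, not_not,
        not_lt] at hx hy h
      omega)

theorem EllTwo.leftShift_apply (r : ℕ) (z : EllTwo) (m : ℕ) :
    EllTwo.leftShift r z m = z (m + r) :=
  (EllTwo.weightedComp_apply _ _ z m).trans (one_mul _)

theorem EllTwo.rightShift_apply (r : ℕ) (z : EllTwo) (m : ℕ) :
    EllTwo.rightShift r z m = if m < r then 0 else z (m - r) :=
  (EllTwo.weightedComp_apply _ _ z m).trans (by rw [ite_mul, zero_mul, one_mul])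

theorem EllTwo.leftShift_mul_rightShift (r : ℕ) :
    EllTwo.leftShift r * EllTwo.rightShift r = 1 := by
  ext z m
  simp [EllTwo.leftShift_apply, EllTwo.rightShift_apply]

theorem memℓp_two_nat_add_iff {y : ℕ → ℂ} (N : ℕ) :
    Memℓp (fun m => y (m + N)) 2 ↔ Memℓp y 2 := by
  have h2 : 0 < (2 : ℝ≥0∞).toReal := by norm_num
  rw [memℓp_gen_iff h2, memℓp_gen_iff h2]
  exact summable_nat_add_iff (f := fun m => ‖y m‖ ^ (2 : ℝ≥0∞).toReal) N

end WeightedComposition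

/-! ### Dimension of the square-summable solution space. -/

section Recurrence

/-- The square-summable solutions of `∑_{r < k} c_{m,r} y_{m+r} = 0`, `m = 0, 1, …`. -/
def ellTwoKernel (k : ℕ) (c : ℕ → ℕ → ℂ) : Submodule ℂ (ℕ → ℂ) where
  carrier := {y | Memℓp y 2 ∧ ∀ m, ∑ r ∈ Finset.range k, c m r * y (m + r) = 0}
  zero_mem' := ⟨zero_memℓp, fun m => by simp⟩
  add_mem' := by
    rintro x y ⟨hx, hx'⟩ ⟨hy, hy'⟩
    refine ⟨hx.add hy, fun m => ?_⟩
    simp only [Pi.add_apply, mul_add, Finset.sum_add_distrib, hx' m, hy' m, add_zero]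
  smul_mem' := by
    rintro a x ⟨hx, hx'⟩
    refine ⟨hx.const_smul a, fun m => ?_⟩
    simp only [Pi.smul_apply, smul_eq_mul, mul_left_comm _ a, ← Finset.mul_sum, hx' m, mul_zero]

/-- If the lowest coefficients do not vanish, dropping the first equation and the first term of the
sequence is a bijection of the solution spaces. -/
theorem rank_ellTwoKernel_succ {k : ℕ} {c : ℕ → ℕ → ℂ} (hc : c 0 0 ≠ 0) :
    Module.rank ℂ (ellTwoKernel (k + 1) fun m => c (m + 1)) =
      Module.rank ℂ (ellTwoKernel (k + 1) c) := by
  let f : ellTwoKernel (k + 1) c →ₗ[ℂ] ellTwoKernel (k + 1) fun m => c (m + 1) :=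
    { toFun := fun y => ⟨fun m => (y : ℕ → ℂ) (m + 1), (memℓp_two_nat_add_iff 1).2 y.2.1,
        fun m => by simpa only [add_right_comm] using y.2.2 (m + 1)⟩
      map_add' := fun _ _ => rfl
      map_smul' := fun _ _ => rfl }
  refine (LinearEquiv.ofBijective f ⟨?_, ?_⟩).rank_eq.symm
  · rw [injective_iff_map_eq_zero]
    rintro ⟨y, hy⟩ h
    have h' : ∀ m, y (m + 1) = 0 := fun m => congrFun (congrArg Subtype.val h) m
    have h0 := hy.2 0
    simp only [zero_add, Finset.sum_range_succ', h', mul_zero, Finset.sum_const_zero] at h0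
    ext m
    cases m with
    | zero => exact (mul_eq_zero.1 h0).resolve_left hc
    | succ m => exact h' m
  · rintro ⟨z, hz⟩
    -- The new leading term is forced by equation `0`, solved for `y 0`.
    let y : ℕ → ℂ := fun m =>
      Nat.casesOn m (-(∑ r ∈ Finset.range k, c 0 (r + 1) * z r) / c 0 0) z
    refine ⟨⟨y, (memℓp_two_nat_add_iff 1).1 hz.1, fun m => ?_⟩, rfl⟩
    cases m with
    | zero =>
      simp only [zero_add, Finset.sum_range_succ']
      change ∑ r ∈ Finset.range k, c 0 (r + 1) * z r +
        c 0 0 * (-(∑ r ∈ Finset.range k, c 0 (r + 1) * z r) / c 0 0) = 0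
      rw [mul_div_cancel₀ _ hc, add_neg_cancel]
    | succ m => simpa only [add_right_comm m 1] using hz.2 m

theorem rank_ellTwoKernel_add {k : ℕ} {c : ℕ → ℕ → ℂ} (hc : ∀ m, c m 0 ≠ 0) (N : ℕ) :
    Module.rank ℂ (ellTwoKernel (k + 1) fun m => c (m + N)) =
      Module.rank ℂ (ellTwoKernel (k + 1) c) := by
  induction N with
  | zero => rfl
  | succ N ih =>
    have e : (fun m => c (m + (N + 1))) = fun m => c (m + 1 + N) := by
      simp only [add_comm N 1, add_assoc]
    rw [← ih, e]
    exact rank_ellTwoKernel_succ (c := fun m => c (m + N)) (hc _)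

/-- If the operator of the recurrence, completed by the first `p` coordinates, is invertible,
then a square-summable solution is determined by its first `p` terms, which are arbitrary. -/
theorem rank_ellTwoKernel_of_isUnit {k p : ℕ} {c : ℕ → ℕ → ℂ} {T : EllTwo →L[ℂ] EllTwo}
    (hT : ∀ z m, T z m = ∑ r ∈ Finset.range k, c m r * z (m + r))
    (hu : IsUnit ((1 - EllTwo.rightShift p * EllTwo.leftShift p) + EllTwo.rightShift p * T)) :
    Module.rank ℂ (ellTwoKernel k c) = p := by
  set Φ := (1 - EllTwo.rightShift p * EllTwo.leftShift p) + EllTwo.rightShift p * T with hΦ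
  have hΦa : ∀ z m, Φ z m = if m < p then z m else T z (m - p) := fun z m => by
    have : Φ z = (z - EllTwo.rightShift p (EllTwo.leftShift p z)) +
      EllTwo.rightShift p (T z) := rfl
    rw [this, lp.coeFn_add, Pi.add_apply, lp.coeFn_sub, Pi.sub_apply, EllTwo.rightShift_apply,
      EllTwo.rightShift_apply]
    split_ifs with h
    · simp
    · rw [EllTwo.leftShift_apply, Nat.sub_add_cancel (not_lt.1 h)]
      simp
  obtain ⟨u, hu⟩ := hu
  have hleft : ∀ z, (↑u⁻¹ : EllTwo →L[ℂ] EllTwo) (Φ z) = z := fun z => by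
    rw [← hu]; exact DFunLike.congr_fun u.inv_mul z
  have hright : ∀ z, Φ ((↑u⁻¹ : EllTwo →L[ℂ] EllTwo) z) = z := fun z => by
    rw [← hu]; exact DFunLike.congr_fun u.mul_inv z
  let f : ellTwoKernel k c →ₗ[ℂ] (Fin p → ℂ) :=
    { toFun := fun y i => (y : ℕ → ℂ) i
      map_add' := fun _ _ => rfl
      map_smul' := fun _ _ => rfl }
  have hf : Function.Bijective f := by
    constructor
    · rw [injective_iff_map_eq_zero]
      rintro ⟨y, hy⟩ h
      let z : EllTwo := ⟨y, hy.1⟩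
      have hz : Φ z = 0 := by
        ext m
        rw [hΦa]
        split_ifs with hm
        · exact congrFun h ⟨m, hm⟩
        · rw [hT]; exact hy.2 _
      have hz0 : z = 0 := by rw [← hleft z, hz, map_zero]
      exact Subtype.ext (congrArg (fun x : EllTwo => (x : ℕ → ℂ)) hz0)
    · intro v
      -- The prescribed initial values followed by the zero right-hand sides of the equations.
      let w : ℕ → ℂ := fun m => if h : m < p then v ⟨m, h⟩ else 0
      have hw : Memℓp w 2 := by
        refine (memℓp_two_nat_add_iff p).1 ?_
        have : (fun m => w (m + p)) = 0 := by ext m; simp [w]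
        rw [this]
        exact zero_memℓp
      let z := (↑u⁻¹ : EllTwo →L[ℂ] EllTwo) ⟨w, hw⟩
      have hz : ∀ m, (if m < p then z m else T z (m - p)) = w m := fun m => by
        rw [← hΦa, hright]
      refine ⟨⟨z, lp.memℓp z, fun m => ?_⟩, funext fun i => ?_⟩
      · have := hz (m + p)
        rw [← hT]
        simpa [w] using this
      · have := hz i
        simp only [i.2, if_true, w, dif_pos] at this
        exact this
  rw [(LinearEquiv.ofBijective f hf).rank_eq, rank_fin_fun]

/-- Only the limits of the coefficients matter: a late enough tail is a norm-small perturbation of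
the limit recurrence, and units form an open set. -/
theorem rank_ellTwoKernel {p : ℕ} {c : ℕ → ℕ → ℂ} {lam : ℂ} (hc : ∀ m, c m 0 ≠ 0)
    (hlim : ∀ r ∈ Finset.range (2 * p + 1), Tendsto (fun m => c m r) atTop
      (𝓝 ((if 0 = r then 1 else 0) + (if 2 * p = r then 1 else 0) - if p = r then lam else 0)))
    (hlam : ∀ x : ℝ, x ∈ Set.Icc (-2 : ℝ) 2 → lam ≠ (x : ℂ)) :
    Module.rank ℂ (ellTwoKernel (2 * p + 1) c) = p := by
  set γ : ℕ → ℂ := fun r =>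
    (if 0 = r then 1 else 0) + (if 2 * p = r then 1 else 0) - if p = r then lam else 0 with hγ
  obtain ⟨a, ha0, ha, hab⟩ := exists_add_inv_eq_of_forall_ne_real hlam
  set S := EllTwo.leftShift p with hS
  set R := EllTwo.rightShift p with hR
  have hR1 : ‖R‖ ≤ 1 := EllTwo.norm_weightedComp_le _ _
  have hunit := isUnit_boundary_add_factored (EllTwo.leftShift_mul_rightShift p)
    (EllTwo.norm_weightedComp_le _ _) hR1 ha0 ha
  rw [← hS, ← hR] at hunit
  set T₀ := (S - a⁻¹ • 1) * (S - a • 1) with hT₀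
  have hT₀a : ∀ z m, T₀ z m = z m + z (m + 2 * p) - lam * z (m + p) := fun z m => by
    have : T₀ z = (S (S z - a • z)) - a⁻¹ • (S z - a • z) := rfl
    rw [this]
    simp only [lp.coeFn_sub, lp.coeFn_smul, Pi.sub_apply, Pi.smul_apply, smul_eq_mul, hS,
      EllTwo.leftShift_apply, add_assoc, ← two_mul]
    rw [← hab]
    linear_combination (z m) * (inv_mul_cancel₀ ha0)
  obtain ⟨δ, hδ, hball⟩ := Metric.isOpen_iff.1 (Units.isOpen (R := EllTwo →L[ℂ] EllTwo)) _ hunit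
  -- There are `2 * p + 1` perturbing weighted shifts, each of norm at most `ε`, and `‖R‖ ≤ 1`; in
  -- total the completed operator moves by at most `δ / 2`.
  set ε : ℝ := δ / (2 * (2 * p + 1)) with hε
  have hε0 : 0 < ε := by positivity
  obtain ⟨N, hN⟩ : ∃ N, ∀ m ≥ N, ∀ r ∈ Finset.range (2 * p + 1), ‖c m r - γ r‖ ≤ ε := by
    rw [← eventually_atTop, Filter.eventually_all_finset]
    intro r hr
    filter_upwards [Metric.tendsto_nhds.1 (hlim r hr) ε hε0] with m hm
    rw [dist_eq_norm] at hm
    exact hm.le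
  -- The cutoff at `2 * p + 1` makes the bound, and hence `W r`, available for every natural `r`.
  have hd : ∀ r, ∀ m, ‖if r < 2 * p + 1 then c (m + N) r - γ r else 0‖ ≤ ε := fun r m => by
    split_ifs with h
    · exact hN _ (Nat.le_add_left _ _) r (Finset.mem_range.2 h)
    · simpa using hε0.le
  let W : ℕ → EllTwo →L[ℂ] EllTwo := fun r =>
    EllTwo.weightedComp (fun m => if r < 2 * p + 1 then c (m + N) r - γ r else 0) (· + r) ε (hd r)
      (fun x _ y _ h => by simpa using h)
  rw [← rank_ellTwoKernel_add hc N]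
  refine rank_ellTwoKernel_of_isUnit (T := T₀ + ∑ r ∈ Finset.range (2 * p + 1), W r) ?_
    (hball ?_)
  · intro z m
    have hsum : (T₀ + ∑ r ∈ Finset.range (2 * p + 1), W r) z m =
        T₀ z m + ∑ r ∈ Finset.range (2 * p + 1), (c (m + N) r - γ r) * z (m + r) := by
      rw [add_apply, lp.coeFn_add, Pi.add_apply,
        sum_apply, lp.coeFn_sum, Finset.sum_apply]
      congr 1
      refine Finset.sum_congr rfl fun r hr => ?_
      exact (EllTwo.weightedComp_apply _ _ z m).trans
        (by rw [if_pos (Finset.mem_range.1 hr)])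
    have hγs : ∑ r ∈ Finset.range (2 * p + 1), γ r * z (m + r) = T₀ z m := by
      rw [hT₀a]
      have h1 : p < 2 * p + 1 := by omega
      simp [hγ, add_mul, sub_mul, Finset.sum_add_distrib, Finset.sum_sub_distrib, ite_mul, h1]
    rw [hsum, ← hγs]
    simp only [sub_mul, Finset.sum_sub_distrib, add_sub_cancel]
  · rw [mem_ball_iff_norm, mul_add, ← add_assoc, add_sub_cancel_left]
    calc ‖R * ∑ r ∈ Finset.range (2 * p + 1), W r‖
        ≤ 1 * ‖∑ r ∈ Finset.range (2 * p + 1), W r‖ :=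
          (norm_mul_le _ _).trans (mul_le_mul_of_nonneg_right hR1 (norm_nonneg _))
      _ ≤ ∑ r ∈ Finset.range (2 * p + 1), ε := by
          rw [one_mul]
          exact norm_sum_le_of_le _ fun r _ => EllTwo.norm_weightedComp_le _ _
      _ = δ / 2 := by
          rw [Finset.sum_const, Finset.card_range, nsmul_eq_mul, hε]
          push_cast
          field_simp
      _ < δ := half_lt_self hδ

end Recurrence

/-! ### Application to the banded matrix and its eigenvalues. -/

namespace StabilizingBandedMatrix

variable {p : ℕ} (D : StabilizingBandedMatrix p)

theorem isSolution_iff {lam : ℂ} {y : ℕ → ℂ} : D.IsSolution lam y ↔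
    ∀ m, ∑ r ∈ Finset.range (2 * p + 1),
      (D.extEntry (m + p) (m + r) - if p = r then lam else 0) * y (m + r) = 0 := by
  refine forall_congr' fun m => ?_
  have h1 : p < 2 * p + 1 := by omega
  have h2 : Finset.Icc m (m + 2 * p) = Finset.Ico m (m + (2 * p + 1)) := by
    ext l; simp only [Finset.mem_Icc, Finset.mem_Ico]; omega
  rw [h2, Finset.sum_Ico_eq_sum_range, Nat.add_sub_cancel_left]
  simp [sub_mul, Finset.sum_sub_distrib, h1, sub_eq_zero]

theorem ellTwoSolutions_eq_ellTwoKernel (lam : ℂ) : D.ellTwoSolutions lam =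
    ellTwoKernel (2 * p + 1)
      (fun m r => D.extEntry (m + p) (m + r) - if p = r then lam else 0) := by
  ext y
  exact and_congr_right fun _ => D.isSolution_iff

theorem extEntry_add_self_ne_zero (m : ℕ) : D.extEntry (m + p) m ≠ 0 := by
  rw [extEntry]
  split_ifs with h h'
  · exact D.entry_ne_zero _ _ (by omega)
  · exact one_ne_zero
  · omega

theorem tendsto_extEntry {r : ℕ} (hp : 1 ≤ p) (hr : r ≤ 2 * p) :
    Tendsto (fun m => D.extEntry (m + p) (m + r)) atTop
      (𝓝 ((if 0 = r then 1 else 0) + if 2 * p = r then 1 else 0)) := by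
  -- For `m ≥ p` all columns `m + r` lie in the range of the original matrix.
  have hev : ∀ᶠ m in atTop, D.entry m (m + r - p) = D.extEntry (m + p) (m + r) := by
    filter_upwards [eventually_ge_atTop p] with m hm
    rw [extEntry, if_pos ⟨by omega, by omega⟩, Nat.add_sub_cancel]
  refine Tendsto.congr' hev ?_
  rcases le_or_gt p r with h | h
  · obtain ⟨s, rfl⟩ := Nat.exists_eq_add_of_le h
    have e : ∀ m, m + (p + s) - p = m + s := fun m => by omega
    simp only [e]
    rw [if_neg (by omega), zero_add]
    split_ifs with h'
    · obtain rfl : p = s := by omega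
      exact D.tendsto_upper
    · exact D.tendsto_inner_upper s (by omega)
  -- Here `p = r + s + 1`: this is the diagonal `s + 1` below the main one, and moving the row index
  -- by `s + 1` removes the truncated subtraction.
  · obtain ⟨s, hs⟩ := Nat.exists_eq_add_of_lt h
    rw [← tendsto_add_atTop_iff_nat (s + 1)]
    have e : ∀ m, m + (s + 1) + r - p = m := fun m => by omega
    simp only [e]
    rw [if_neg (by omega : ¬ 2 * p = r), add_zero]
    split_ifs with h'
    · obtain rfl : p = s + 1 := by omega
      exact D.tendsto_lower
    · exact D.tendsto_inner_lower (s + 1) (by omega)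

theorem rank_ellTwoSolutions (hp : 1 ≤ p) {lam : ℂ}
    (hlam : ∀ x : ℝ, x ∈ Set.Icc (-2 : ℝ) 2 → lam ≠ (x : ℂ)) :
    Module.rank ℂ (D.ellTwoSolutions lam) = p := by
  rw [ellTwoSolutions_eq_ellTwoKernel]
  refine rank_ellTwoKernel (fun m => ?_) (fun r hr => ?_) hlam
  · rw [if_neg (by omega), sub_zero]
    exact D.extEntry_add_self_ne_zero m
  · exact (D.tendsto_extEntry hp (by rw [Finset.mem_range] at hr; omega)).sub_const _

theorem sum_extEntry_mul_of_eq_zero {y : ℕ → ℂ} (hy : ∀ l < p, y l = 0) (m : ℕ) :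
    ∑ l ∈ Finset.Icc m (m + 2 * p), D.extEntry (m + p) l * y l =
      D.mulVec (fun k => y (k + p)) m := by
  -- The added terms vanish: for `l < p` because `y l = 0`, for `p ≤ l < m` because the entry is
  -- outside the band.
  have h1 : ∑ l ∈ Finset.Icc m (m + 2 * p), D.extEntry (m + p) l * y l =
      ∑ l ∈ Finset.range (p + (m + p + 1)), D.extEntry (m + p) l * y l := by
    refine Finset.sum_subset (fun l hl => ?_) fun l hl hl' => ?_
    · rw [Finset.mem_Icc] at hl
      rw [Finset.mem_range]
      omega
    · rw [Finset.mem_Icc] at hl'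
      rw [Finset.mem_range] at hl
      rcases lt_or_ge l p with h | h
      · rw [hy l h, mul_zero]
      · rw [extEntry, if_pos ⟨by omega, h⟩, D.entry_eq_zero _ _ (by omega), zero_mul]
  rw [h1, Finset.sum_range_add, Finset.sum_eq_zero fun l hl => by
    rw [hy l (Finset.mem_range.1 hl), mul_zero], zero_add, mulVec,
    tsum_eq_sum (s := Finset.range (m + p + 1))]
  · refine Finset.sum_congr rfl fun l _ => ?_
    rw [extEntry, if_pos ⟨by omega, by omega⟩, Nat.add_sub_cancel, Nat.add_sub_cancel_left,
      add_comm p l]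
  · intro l hl
    rw [Finset.mem_range] at hl
    rw [D.entry_eq_zero _ _ (by omega), zero_mul]

/-- Eigenvectors correspond to the square-summable solutions which start with `p` zeros. -/
theorem hasEigenvalue_operator_iff (lam : ℂ) :
    Module.End.HasEigenvalue (D.operator : EllTwo →ₗ[ℂ] EllTwo) lam ↔
      ∃ y ∈ D.ellTwoSolutions lam, y ≠ 0 ∧ ∀ l < p, y l = 0 := by
  constructor
  · intro h
    obtain ⟨x, hx⟩ := h.exists_hasEigenvector
    let y : ℕ → ℂ := fun l => if l < p then 0 else x (l - p)
    have hyx : (fun k => y (k + p)) = x := by ext k; simp [y]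
    have hy0 : ∀ l < p, y l = 0 := fun l hl => if_pos hl
    refine ⟨y, ⟨(memℓp_two_nat_add_iff p).1 (hyx ▸ lp.memℓp x), fun m => ?_⟩, ?_, hy0⟩
    · rw [D.sum_extEntry_mul_of_eq_zero hy0, hyx]
      have := congrArg (fun z : EllTwo => z m) hx.apply_eq_smul
      rw [show y (m + p) = x m from congrFun hyx m]
      exact this
    · intro h0
      apply hx.2
      ext k
      rw [← hyx, h0]
      rfl
  · rintro ⟨y, ⟨hy, hs⟩, hne, hy0⟩
    let x : EllTwo := ⟨fun k => y (k + p), (memℓp_two_nat_add_iff p).2 hy⟩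
    refine Module.End.hasEigenvalue_of_hasEigenvector (x := x)
      (Module.End.hasEigenvector_iff.2 ⟨Module.End.mem_eigenspace_iff.2 ?_, fun h0 => hne ?_⟩)
    · ext m
      exact (D.sum_extEntry_mul_of_eq_zero hy0 m).symm.trans (hs m)
    · ext l
      rcases lt_or_ge l p with h | h
      · exact hy0 l h
      · have : y (l - p + p) = 0 := congrFun (congrArg Subtype.val h0) (l - p)
        rwa [Nat.sub_add_cancel h] at this

end StabilizingBandedMatrix

theorem proposition2p2 (p : ℕ) (hp : 1 ≤ p) (D : StabilizingBandedMatrix p) (lam : ℂ)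
    (hlam : ∀ x : ℝ, x ∈ Set.Icc (-2 : ℝ) 2 → lam ≠ (x : ℂ)) :
    Module.rank ℂ (D.ellTwoSolutions lam) = (p : Cardinal) ∧
    ∀ y : Fin p → (ℕ → ℂ), (∀ i, y i ∈ D.ellTwoSolutions lam) → LinearIndependent ℂ y →
      (Module.End.HasEigenvalue (D.operator : EllTwo →ₗ[ℂ] EllTwo) lam ↔
        Matrix.det (Matrix.of fun i j : Fin p => y i (j : ℕ)) = 0) := by
  have hrank := D.rank_ellTwoSolutions hp hlam
  refine ⟨hrank, fun y hy hli => ?_⟩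
  have hfin : Module.finrank ℂ (D.ellTwoSolutions lam) = p := Module.finrank_eq_of_rank_eq hrank
  have : FiniteDimensional ℂ (D.ellTwoSolutions lam) :=
    Module.finite_of_finrank_pos (by omega)
  -- By the dimension count, `p` independent solutions form a basis.
  have hspan : Submodule.span ℂ (Set.range y) = D.ellTwoSolutions lam := by
    refine Submodule.eq_of_le_of_finrank_eq (Submodule.span_le.2 ?_) ?_
    · rintro _ ⟨i, rfl⟩
      exact hy i
    · rw [finrank_span_eq_card hli, hfin, Fintype.card_fin]
  -- Multiplying the matrix by a row `v` gives the first `p` terms of the solution with coordinates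
  -- `v`.
  have hcomb : ∀ (v : Fin p → ℂ) (l : Fin p),
      Matrix.vecMul v (Matrix.of fun i j : Fin p => y i (j : ℕ)) l = (∑ i, v i • y i) l :=
    fun v l => by
      simp [Matrix.vecMul, dotProduct]
  rw [D.hasEigenvalue_operator_iff, ← Matrix.exists_vecMul_eq_zero_iff]
  constructor
  · rintro ⟨z, hz, hne, hz0⟩
    rw [← hspan, Submodule.mem_span_range_iff_exists_fun] at hz
    obtain ⟨v, rfl⟩ := hz
    refine ⟨v, ?_, funext fun l => ?_⟩
    · rintro rfl
      simp at hne
    · rw [hcomb]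
      exact hz0 l l.2
  · rintro ⟨v, hv, hv0⟩
    refine ⟨∑ i, v i • y i, Submodule.sum_mem _ fun i _ => Submodule.smul_mem _ _ (hy i),
      fun h => hv (funext fun i => Fintype.linearIndependent_iff.1 hli v h i), fun l hl => ?_⟩
    rw [← hcomb v ⟨l, hl⟩, hv0]
    rfl
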